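/- Every separable metrizable abelian topological group $H$ is (isomorphic, algebraically and topologically, to) a topological subgroup of a separable metrizable divisible abelian topological group $G$; if moreover $H$ has no torsion, then $G$ can be chosen without torsion. Here an abelian group $A$ is divisible (respectively, has no torsion) if for every $a\in A$ and every positive integer $n$ the equation $nx=a$ has a solution $x\in A$ (respectively, has at most one solution $x\in A$). -/

import Mathlib

universe u

open Topology Filter

/-! Give `H` an invariant norm and let `j : A →+ H` have dense range, with `A` countable. Divide `H
× ℓ¹(A)` by the closed subgroup generated by the pairs `(j a, ‖j a‖ e_a)`. On it the first
coordinate is dominated by the second, so `H` still embeds. Every `h` is a first coordinate of it,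
so each class has a representative in the real vector space `ℓ¹(A)`, whence divisibility. In the
torsion-free case, the torsion subgroup of the quotient is divisible, hence a direct summand, with a
complement that can be chosen to contain `H`. -/

/-- A topological abelian group that is metrizable carries a compatible invariant norm. -/
theorem exists_addGroupNorm_topology_eq (H : Type*) [AddCommGroup H] [τ : TopologicalSpace H]
    [IsTopologicalAddGroup H] [TopologicalSpace.MetrizableSpace H] :
    ∃ N : AddGroupNorm H,
      τ = N.toNormedAddCommGroup.toPseudoMetricSpace.toUniformSpace.toTopologicalSpace := by
  obtain ⟨m, hm⟩ : ∃ m : MetricSpace H,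
      m.toUniformSpace = IsTopologicalAddGroup.rightUniformSpace H := by
    let := IsTopologicalAddGroup.rightUniformSpace H
    have : IsUniformAddGroup H := isUniformAddGroup_of_addCommGroup
    have : (uniformity H).IsCountablyGenerated := IsUniformAddGroup.uniformity_countably_generated
    exact ⟨UniformSpace.metricSpace H, rfl⟩
  have hτ : τ = m.toUniformSpace.toTopologicalSpace := by rw [hm]; rfl
  have hunif : ∀ ε > 0, ∀ᶠ x in @nhds H τ 0, ∀ z, dist (x + z) z < ε := by
    intro ε hε
    have h1 : {p : H × H | dist p.1 p.2 < ε} ∈ m.toUniformSpace.uniformity :=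
      Metric.dist_mem_uniformity hε
    rw [hm] at h1
    change _ ∈ Filter.comap _ _ at h1
    obtain ⟨U, hU, hUs⟩ := h1
    have hU' : ∀ᶠ x in @nhds H τ 0, -x ∈ U :=
      (continuous_neg.tendsto' (0 : H) 0 neg_zero).eventually hU
    filter_upwards [hU'] with x hx z
    exact hUs (show (x + z, z) ∈ _ by simpa using hx)
  -- Truncation keeps the supremum over translates finite; that supremum is the invariant norm.
  let ρ : H → H → ℝ := fun x y ↦ min 1 (dist x y)
  have hbdd : ∀ x, BddAbove (Set.range fun z ↦ ρ (x + z) z) := fun x ↦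
    ⟨1, by rintro _ ⟨z, rfl⟩; exact min_le_left _ _⟩
  have hle : ∀ x z, ρ (x + z) z ≤ ⨆ z, ρ (x + z) z := fun x z ↦ le_ciSup (hbdd x) z
  have hneg : ∀ x, (⨆ z, ρ (-x + z) z) ≤ ⨆ z, ρ (x + z) z := fun x ↦ by
    refine ciSup_le fun z ↦ ?_
    have := hle x (-x + z)
    rwa [add_neg_cancel_left, show ρ z (-x + z) = ρ (-x + z) z by simp [ρ, dist_comm]] at this
  let N : AddGroupNorm H :=
    { toFun := fun x ↦ ⨆ z, ρ (x + z) z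
      map_zero' := by simp [ρ]
      add_le' := fun x y ↦ by
        refine ciSup_le fun z ↦ ?_
        refine le_trans ?_ (add_le_add (hle x (y + z)) (hle y z))
        have h := dist_triangle (x + (y + z)) (y + z) z
        have h1 : 0 ≤ dist (x + (y + z)) (y + z) := dist_nonneg
        have h2 : 0 ≤ dist (y + z) z := dist_nonneg
        simp only [ρ, add_assoc]
        grind
      neg' := fun x ↦ le_antisymm (hneg x) (by simpa using hneg (-x))
      eq_zero_of_map_eq_zero' := fun x hx ↦ by
        have h := (hle x 0).trans_eq hx
        have h2 : dist x 0 ≤ 0 := by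
          rw [add_zero] at h
          exact (min_le_iff.1 h).resolve_left (by norm_num)
        exact dist_le_zero.1 h2 }
  refine ⟨N, ?_⟩
  let τ' := N.toNormedAddCommGroup.toPseudoMetricSpace.toUniformSpace.toTopologicalSpace
  have hg' : @IsTopologicalAddGroup H τ' _ := by
    let := N.toNormedAddCommGroup
    infer_instance
  refine IsTopologicalAddGroup.ext inferInstance hg' ?_
  have hb' : (@nhds H τ' 0).HasBasis (fun ε : ℝ ↦ 0 < ε) fun ε ↦ {x | N x < ε} := by
    let := N.toNormedAddCommGroup
    exact NormedAddGroup.nhds_zero_basis_norm_lt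
  have hb : (@nhds H τ 0).HasBasis (fun ε : ℝ ↦ 0 < ε) fun ε ↦ Metric.ball 0 ε := by
    rw [hτ]; exact Metric.nhds_basis_ball
  refine le_antisymm ?_ ?_
  · refine hb'.ge_iff.2 fun ε hε ↦ ?_
    filter_upwards [hunif (ε / 2) (half_pos hε)] with x hx
    refine lt_of_le_of_lt (ciSup_le fun z ↦ ?_) (half_lt_self hε)
    exact (min_le_right _ _).trans (hx z).le
  · refine hb.ge_iff.2 fun ε hε ↦ ?_
    refine hb'.mem_iff.2 ⟨min 1 ε, lt_min one_pos hε, fun x hx ↦ ?_⟩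
    have h1 : ρ (x + 0) 0 < min 1 ε := (hle x 0).trans_lt hx
    simp only [ρ, add_zero] at h1
    rw [Metric.mem_ball]
    grind

/-- `ℓ¹(ι, ℝ)` is separable for countable `ι`. -/
theorem separableSpace_lp_one (ι : Type*) [Countable ι] :
    TopologicalSpace.SeparableSpace (lp (fun _ : ι ↦ ℝ) 1) := by
  classical
  let s : Set (lp (fun _ : ι ↦ ℝ) 1) := Set.range fun i ↦ lp.single 1 i (1 : ℝ)
  have hs : TopologicalSpace.IsSeparable (Submodule.span ℝ s : Set (lp (fun _ : ι ↦ ℝ) 1)) :=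
    (Set.countable_range _).isSeparable.span
  rw [← TopologicalSpace.isSeparable_univ_iff]
  refine hs.closure.mono fun f _ ↦ ?_
  refine mem_closure_of_tendsto (lp.hasSum_single ENNReal.one_ne_top f)
    (Eventually.of_forall fun t ↦ Submodule.sum_mem _ fun i _ ↦ ?_)
  have : lp.single 1 i (f i) = f i • (lp.single 1 i (1 : ℝ) : lp (fun _ : ι ↦ ℝ) 1) := by
    rw [← lp.single_smul]; simp
  rw [this]
  exact Submodule.smul_mem _ _ (Submodule.subset_span ⟨i, rfl⟩)

section Pushout

variable {H : Type*} [NormedAddCommGroup H] {ι : Type*}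

open Classical in
/-- The homomorphism sending the `i`-th basis vector to `(x i, ‖x i‖ eᵢ)`. -/
noncomputable def weightedGraphHom (x : ι → H) : (ι →₀ ℤ) →+ H × lp (fun _ : ι ↦ ℝ) 1 :=
  (Finsupp.linearCombination ℤ fun i ↦ (x i, lp.single 1 i ‖x i‖)).toAddMonoidHom

/-- The closed subgroup of `H × ℓ¹(ι, ℝ)` generated by the elements `(x i, ‖x i‖ eᵢ)`. -/
noncomputable def weightedGraph (x : ι → H) : AddSubgroup (H × lp (fun _ : ι ↦ ℝ) 1) :=
  (weightedGraphHom x).range.topologicalClosure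

/-- The `ℓ¹` norm of the second coordinate is exactly `∑ |c i| ‖x i‖`, so this is the triangle
inequality. -/
theorem norm_fst_weightedGraphHom_le (x : ι → H) (c : ι →₀ ℤ) :
    ‖(weightedGraphHom x c).1‖ ≤ ‖(weightedGraphHom x c).2‖ := by
  classical
  have h1 : (weightedGraphHom x c).1 = ∑ i ∈ c.support, c i • x i := by
    simp [weightedGraphHom, Finsupp.linearCombination_apply, Finsupp.sum, Prod.fst_sum]
  have h2 : (weightedGraphHom x c).2
      = ∑ i ∈ c.support, lp.single 1 i ((c i : ℝ) * ‖x i‖) := by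
    simp only [weightedGraphHom, Finsupp.linearCombination_apply, Finsupp.sum,
      LinearMap.toAddMonoidHom_coe, Prod.snd_sum, Prod.smul_snd]
    refine Finset.sum_congr rfl fun i _ ↦ ?_
    rw [← zsmul_eq_mul]
    exact (map_zsmul (lp.singleAddMonoidHom (E := fun _ : ι ↦ ℝ) 1 i) _ _).symm
  have h3 := lp.norm_sum_single (E := fun _ : ι ↦ ℝ) (p := 1) (by simp)
    (fun i ↦ (c i : ℝ) * ‖x i‖) c.support
  simp only [ENNReal.toReal_one, Real.rpow_one] at h3
  rw [h1, h2, h3]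
  refine (norm_sum_le _ _).trans (Finset.sum_le_sum fun i _ ↦ ?_)
  rw [norm_mul, norm_norm]
  exact (norm_zsmul_le (c i) (x i)).trans_eq (by rw [Int.norm_eq_abs, Real.norm_eq_abs])

theorem norm_fst_le_of_mem_weightedGraph (x : ι → H) {p : H × lp (fun _ : ι ↦ ℝ) 1}
    (hp : p ∈ weightedGraph x) : ‖p.1‖ ≤ ‖p.2‖ := by
  have hcl : IsClosed {p : H × lp (fun _ : ι ↦ ℝ) 1 | ‖p.1‖ ≤ ‖p.2‖} :=
    isClosed_le (by fun_prop) (by fun_prop)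
  refine closure_minimal ?_ hcl hp
  rintro _ ⟨c, rfl⟩
  exact norm_fst_weightedGraphHom_le x c

/-- Density writes `h` as a series of terms `j (a n)` with summable norms; the weights then make the
second coordinates converge in `ℓ¹`, and the graph is closed. -/
theorem exists_mem_weightedGraph {A : Type*} [AddCommGroup A] (j : A →+ H) (hj : DenseRange j)
    (h : H) : ∃ v, (h, v) ∈ weightedGraph j := by
  classical
  obtain ⟨u, hu, hur, -, hb⟩ := controlled_sum_of_mem_closure (s := j.range) (a := h)
    (hj h) (b := fun n ↦ (1 / 2 : ℝ) ^ n) (fun n ↦ by positivity)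
  choose a ha using hur
  obtain rfl : u = fun n ↦ j (a n) := funext fun n ↦ (ha n).symm
  let w : ℕ → lp (fun _ : A ↦ ℝ) 1 := fun n ↦ lp.single 1 (a n) ‖j (a n)‖
  have hw : Summable w := by
    -- The bound on `‖j (a n)‖` is only available for `n > 0`, hence the shift.
    refine Summable.of_norm ((summable_nat_add_iff 1).1 ?_)
    refine Summable.of_nonneg_of_le (fun n ↦ norm_nonneg _) (fun n ↦ ?_)
      ((summable_nat_add_iff 1).2 summable_geometric_two)
    rw [lp.norm_single one_pos, norm_norm]
    exact (hb (n + 1) n.succ_pos).le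
  refine ⟨∑' n, w n, mem_closure_of_tendsto
    (hu.prodMk_nhds ((tendsto_add_atTop_iff_nat 1).2 hw.hasSum.tendsto_sum_nat))
    (Eventually.of_forall fun n ↦ ?_)⟩
  have : (∑ i ∈ Finset.range (n + 1), j (a i), ∑ i ∈ Finset.range (n + 1), w i)
      = ∑ i ∈ Finset.range (n + 1), (j (a i), w i) := by
    rw [Prod.ext_iff, Prod.fst_sum, Prod.snd_sum]; exact ⟨rfl, rfl⟩
  rw [this]
  refine AddSubgroup.sum_mem _ fun i _ ↦ ⟨Finsupp.single (a i) 1, ?_⟩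
  simp [weightedGraphHom, w]

/-- The embedding of `H` into the quotient of `H × ℓ¹(ι, ℝ)` by the weighted graph. -/
noncomputable def toWeightedQuotient (x : ι → H) :
    H →+ (H × lp (fun _ : ι ↦ ℝ) 1) ⧸ weightedGraph x :=
  (QuotientAddGroup.mk' (weightedGraph x)).comp (AddMonoidHom.inl _ _)

theorem isClosed_weightedGraph (x : ι → H) :
    IsClosed (weightedGraph x : Set (H × lp (fun _ : ι ↦ ℝ) 1)) :=
  AddSubgroup.isClosed_topologicalClosure _

theorem isEmbedding_toWeightedQuotient (x : ι → H) : IsEmbedding (toWeightedQuotient x) := by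
  have hcont : Continuous (toWeightedQuotient x) :=
    continuous_quotient_mk'.comp (by fun_prop : Continuous fun h : H ↦
      (h, (0 : lp (fun _ : ι ↦ ℝ) 1)))
  -- For `s` in the graph, `‖h‖ ≤ ‖h + s.1‖ + ‖s.1‖ ≤ ‖h + s.1‖ + ‖s.2‖`, and both terms are at most
  -- `‖(h, 0) + s‖`.
  have hnorm : ∀ h, ‖h‖ ≤ 2 * ‖toWeightedQuotient x h‖ := fun h ↦ by
    refine le_of_forall_pos_lt_add fun ε hε ↦ ?_
    obtain ⟨s, hs, hlt⟩ := QuotientAddGroup.exists_norm_add_lt (weightedGraph x)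
      (h, (0 : lp (fun _ : ι ↦ ℝ) 1)) (half_pos hε)
    change _ < ‖toWeightedQuotient x h‖ + _ at hlt
    have h1 := norm_fst_le_of_mem_weightedGraph x hs
    have h2 : ‖h + s.1‖ < ‖toWeightedQuotient x h‖ + ε / 2 := (norm_fst_le _).trans_lt hlt
    have h3 : ‖s.2‖ < ‖toWeightedQuotient x h‖ + ε / 2 := by
      refine lt_of_le_of_lt ?_ hlt
      simpa using norm_snd_le ((h, (0 : lp (fun _ : ι ↦ ℝ) 1)) + s)
    have h4 : ‖h‖ ≤ ‖h + s.1‖ + ‖s.1‖ := by simpa using norm_sub_le (h + s.1) s.1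
    linarith
  have hanti : AntilipschitzWith 2 (toWeightedQuotient x) :=
    AddMonoidHomClass.antilipschitz_of_bound _ (K := 2) hnorm
  exact (hanti.isUniformEmbedding
    (uniformContinuous_addMonoidHom_of_continuous hcont)).isEmbedding

theorem exists_nsmul_eq_weightedQuotient {A : Type*} [AddCommGroup A] (j : A →+ H)
    (hj : DenseRange j) (n : ℕ) (hn : 0 < n)
    (g : (H × lp (fun _ : A ↦ ℝ) 1) ⧸ weightedGraph j) : ∃ y, n • y = g := by
  obtain ⟨⟨h, v⟩, rfl⟩ := QuotientAddGroup.mk_surjective g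
  obtain ⟨w, hw⟩ := exists_mem_weightedGraph j hj h
  -- Modulo `(h, w)`, the element `(h, v)` is `(0, v - w)`, which can be divided in `ℓ¹`.
  refine ⟨QuotientAddGroup.mk (0, (n : ℝ)⁻¹ • (v - w)), ?_⟩
  rw [← QuotientAddGroup.mk_nsmul, QuotientAddGroup.eq]
  have hn' : (n : ℝ) ≠ 0 := by positivity
  have : n • (n : ℝ)⁻¹ • (v - w) = v - w := by
    rw [← Nat.cast_smul_eq_nsmul ℝ, smul_inv_smul₀ hn']
  convert hw using 1
  simp [this]

end Pushout

/-- In a divisible abelian group, every torsion-free subgroup is contained in a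
torsion-free divisible subgroup. -/
theorem exists_divisible_torsionFree_addSubgroup_ge {G : Type*} [AddCommGroup G]
    (hdiv : ∀ n : ℕ, 0 < n → ∀ a : G, ∃ x : G, n • x = a) (K : AddSubgroup G)
    [IsAddTorsionFree K] :
    ∃ D : AddSubgroup G, K ≤ D ∧ IsAddTorsionFree D ∧
      ∀ n : ℕ, 0 < n → ∀ a : D, ∃ x : D, n • x = a := by
  let T := AddCommGroup.torsion G
  have hT : ∀ n : ℤ, n ≠ 0 → ∀ a : T, ∃ x : T, n • x = a := by
    rintro n hn ⟨a, ha⟩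
    obtain ⟨x, hx⟩ := hdiv n.natAbs (Int.natAbs_pos.2 hn) a
    have hxT : x ∈ T := by
      have ha' : IsOfFinAddOrder (n.natAbs • x) := by rw [hx]; exact ha
      exact ha'.of_nsmul (Int.natAbs_pos.2 hn).ne'
    rcases Int.natAbs_eq n with h | h
    · exact ⟨⟨x, hxT⟩, Subtype.ext (by rw [h, natCast_zsmul]; exact hx)⟩
    · exact ⟨-⟨x, hxT⟩, Subtype.ext (by rw [h, neg_smul_neg, natCast_zsmul]; exact hx)⟩
  let : DivisibleBy T ℤ := divisibleByOfSMulRightSurj T ℤ fun hn a ↦ hT _ hn a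
  let ι : T →+ G ⧸ K := (QuotientAddGroup.mk' K).comp T.subtype
  have hι : Function.Injective ι := by
    rw [injective_iff_map_eq_zero]
    rintro ⟨t, ht⟩ h
    have htK : t ∈ K := (QuotientAddGroup.eq_zero_iff t).1 h
    have hfin : IsOfFinAddOrder (⟨t, htK⟩ : K) :=
      (AddSubmonoid.isOfFinAddOrder_coe (x := (⟨t, htK⟩ : K))).1 ht
    have := isOfFinAddOrder_iff_eq_zero _ |>.1 hfin
    exact Subtype.ext (congrArg (fun k : K ↦ (k : G)) this)
  -- Divisible groups are injective and `T` meets `K` trivially, so the identity of `T` extends to a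
  -- retraction of `G` killing `K`; its kernel is the required subgroup.
  obtain ⟨q, hq⟩ := (Module.Baer.of_divisible T).extension_property_addMonoidHom ι hι
    (AddMonoidHom.id T)
  let p : G →+ T := q.comp (QuotientAddGroup.mk' K)
  have hpT : ∀ t : T, p t = t := fun t ↦ DFunLike.congr_fun hq t
  refine ⟨p.ker, fun k hk ↦ ?_, ?_, ?_⟩
  · change q (k : G ⧸ K) = 0
    rw [(QuotientAddGroup.eq_zero_iff k).2 hk, map_zero]
  · refine IsAddTorsionFree.of_not_isOfFinAddOrder fun a ha hfin ↦ ha ?_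
    have haT : (a : G) ∈ T := AddSubmonoid.isOfFinAddOrder_coe.2 hfin
    have h := hpT ⟨a, haT⟩
    rw [show p a = 0 from a.2] at h
    exact Subtype.ext (congrArg (fun t : T ↦ (t : G)) h.symm)
  · rintro n hn ⟨a, ha⟩
    obtain ⟨x, rfl⟩ := hdiv n hn a
    have hpx : n • p x = 0 := by rw [← map_nsmul]; exact ha
    refine ⟨⟨x - p x, ?_⟩, Subtype.ext ?_⟩
    · rw [AddMonoidHom.mem_ker, map_sub, hpT, sub_self]
    · have : n • (p x : G) = 0 := by exact_mod_cast congrArg Subtype.val hpx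
      simp [nsmul_sub, this]

/-- Every separable normed abelian group embeds in a separable metrizable divisible one. -/
theorem exists_isEmbedding_divisible (H : Type u) [NormedAddCommGroup H]
    [TopologicalSpace.SeparableSpace H] :
    ∃ (G : Type u) (_ : AddCommGroup G) (_ : TopologicalSpace G),
      IsTopologicalAddGroup G ∧
      TopologicalSpace.SeparableSpace G ∧
      TopologicalSpace.MetrizableSpace G ∧
      (∀ n : ℕ, 0 < n → ∀ a : G, ∃ x : G, n • x = a) ∧
      (∃ f : H →+ G, IsEmbedding f) := by
  let j : (ℕ →₀ ℤ) →+ H :=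
    (Finsupp.linearCombination ℤ (TopologicalSpace.denseSeq H)).toAddMonoidHom
  have hj : DenseRange j := by
    refine (TopologicalSpace.denseRange_denseSeq H).mono ?_
    rintro _ ⟨n, rfl⟩
    exact ⟨Finsupp.single n 1, by simp [j]⟩
  have := separableSpace_lp_one (ℕ →₀ ℤ)
  have := isClosed_weightedGraph j
  refine ⟨_ ⧸ weightedGraph j, inferInstance, inferInstance, inferInstance, ?_, inferInstance,
    exists_nsmul_eq_weightedQuotient j hj, toWeightedQuotient j, isEmbedding_toWeightedQuotient j⟩
  exact (QuotientAddGroup.mk_surjective.denseRange).separableSpace continuous_quotient_mk'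

theorem corollary5 (H : Type u) [AddCommGroup H] [TopologicalSpace H] [IsTopologicalAddGroup H]
    [TopologicalSpace.SeparableSpace H] [TopologicalSpace.MetrizableSpace H] :
    ∃ (G : Type u) (_ : AddCommGroup G) (_ : TopologicalSpace G),
      IsTopologicalAddGroup G ∧
      TopologicalSpace.SeparableSpace G ∧
      TopologicalSpace.MetrizableSpace G ∧
      (∀ n : ℕ, 0 < n → ∀ a : G, ∃ x : G, n • x = a) ∧
      (∃ f : H →+ G, Topology.IsEmbedding f) ∧
      (IsAddTorsionFree H → IsAddTorsionFree G) := by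
  obtain ⟨N, hN⟩ := exists_addGroupNorm_topology_eq H
  obtain ⟨G, _, _, _, _, _, hdiv, f, hf⟩ : ∃ (G : Type u) (_ : AddCommGroup G)
      (_ : TopologicalSpace G), IsTopologicalAddGroup G ∧ TopologicalSpace.SeparableSpace G ∧
      TopologicalSpace.MetrizableSpace G ∧ (∀ n : ℕ, 0 < n → ∀ a : G, ∃ x : G, n • x = a) ∧
      (∃ f : H →+ G, IsEmbedding f) := by
    subst hN
    let := N.toNormedAddCommGroup
    exact exists_isEmbedding_divisible H
  by_cases hH : IsAddTorsionFree H
  · have : IsAddTorsionFree f.range :=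
      (AddMonoidHom.ofInjective hf.injective).symm.injective.isAddTorsionFree
        (AddMonoidHom.ofInjective hf.injective).symm.toAddMonoidHom
    obtain ⟨D, hKD, hD, hDdiv⟩ := exists_divisible_torsionFree_addSubgroup_ge hdiv f.range
    -- Separability passes to the subgroup through second countability.
    have hsep : TopologicalSpace.SeparableSpace D := by
      let := TopologicalSpace.metrizableSpaceMetric G
      have := UniformSpace.secondCountable_of_separable G
      infer_instance
    refine ⟨D, inferInstance, inferInstance, inferInstance, hsep,
      IsEmbedding.subtypeVal.metrizableSpace, hDdiv,
      ⟨f.codRestrict D fun h ↦ hKD ⟨h, rfl⟩, ?_⟩, fun _ ↦ hD⟩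
    exact hf.codRestrict (D : Set G) fun h ↦ hKD ⟨h, rfl⟩
  · exact ⟨G, ‹_›, ‹_›, ‹_›, ‹_›, ‹_›, hdiv, ⟨f, hf⟩, fun h ↦ absurd h hH⟩
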